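/- A *free Borel flow* is a free Borel measurable action $(\omega, r) \mapsto \omega + r$ of $\mathbb{R}$ on a standard Borel space $\Omega$. A *cross section* of it is a Borel set $\mathcal{C} \subseteq \Omega$ that meets every orbit, that is lacunary (there is $c > 0$ such that $r \ge c$ whenever $x \in \mathcal{C}$, $r > 0$ and $x + r \in \mathcal{C} \setminus \{x\}$), and that is bi-infinite (for every $x \in \mathcal{C}$ there are $r > 0$ and $r' < 0$ with $x + r, x + r' \in \mathcal{C}$). For $x \in \mathcal{C}$ the gap of $\mathcal{C}$ at $x$ is $\mathrm{gap}_{\mathcal{C}}(x) = \min\{ r > 0 : x + r \in \mathcal{C} \}$. A cross section $\mathcal{C}$ is *sparse* if its gaps are bi-infinitely unbounded on each orbit, i.e. for all $x \in \mathcal{C}$ and $K \in \mathbb{R}$ there are $r \ge 0$ and $r' \le 0$ with $x + r, x + r' \in \mathcal{C}$, $\mathrm{gap}_{\mathcal{C}}(x + r) \ge K$ and $\mathrm{gap}_{\mathcal{C}}(x + r') \ge K$; the flow is *sparse* if it admits a sparse cross section. For $S \subseteq \mathbb{R}^{>0}$, a cross section $\mathcal{C}$ is *$S$-regular* if $\mathrm{gap}_{\mathcal{C}}(x)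 \in S$ for all $x \in \mathcal{C}$. **Theorem.** Let $S \subset \mathbb{R}^{>0}$ be bounded away from zero, i.e. $S \subseteq [c, \infty)$ for some $c > 0$, and suppose that the subgroup $\langle S \rangle$ of $\mathbb{R}$ generated by $S$ is dense in $\mathbb{R}$. Then every sparse free Borel flow has an $S$-regular cross section. -/

import Mathlib

/-! Flows are additive actions of `ℝ` on `Ω`; `r +ᵥ ω` is the action of `r` upon `ω`. -/

namespace BorelFlow

variable {Ω : Type*} [AddAction ℝ Ω]

/-- The action of `ℝ` on `Ω` is free. -/
def IsFree (Ω : Type*) [AddAction ℝ Ω] : Prop :=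
  ∀ (r : ℝ) (ω : Ω), r +ᵥ ω = ω → r = 0

/-- A cross section: a Borel set meeting every orbit, lacunary, and bi-infinite on each orbit
(every point of it has a later and an earlier point of it in its orbit). -/
structure IsCrossSection [MeasurableSpace Ω] (C : Set Ω) : Prop where
  measurableSet : MeasurableSet C
  inter_orbit_nonempty : ∀ ω : Ω, (C ∩ AddAction.orbit ℝ ω).Nonempty
  lacunary : ∃ c : ℝ, 0 < c ∧ ∀ x ∈ C, ∀ r : ℝ, 0 < r → r +ᵥ x ∈ C \ {x} → c ≤ r
  exists_after : ∀ x ∈ C, ∃ r : ℝ, 0 < r ∧ r +ᵥ x ∈ C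
  exists_before : ∀ x ∈ C, ∃ r : ℝ, r < 0 ∧ r +ᵥ x ∈ C

/-- The gap function of `C`: the distance from `x` to the next point of `C` in its orbit. For a
cross section of a free flow the infimum is a minimum, see `isLeast_gap`. -/
noncomputable def gap (C : Set Ω) (x : Ω) : ℝ :=
  sInf {r : ℝ | 0 < r ∧ r +ᵥ x ∈ C}

theorem isLeast_gap [MeasurableSpace Ω] (hfree : IsFree Ω) {C : Set Ω} (hC : IsCrossSection C)
    {x : Ω} (hx : x ∈ C) : IsLeast {r : ℝ | 0 < r ∧ r +ᵥ x ∈ C} (gap C x) := by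
  obtain ⟨c, hc, hlac⟩ := hC.lacunary
  have hne : {r : ℝ | 0 < r ∧ r +ᵥ x ∈ C}.Nonempty := hC.exists_after x hx
  have hbdd : BddBelow {r : ℝ | 0 < r ∧ r +ᵥ x ∈ C} := ⟨0, fun r hr => hr.1.le⟩
  have hlow : ∀ r ∈ {r : ℝ | 0 < r ∧ r +ᵥ x ∈ C}, gap C x ≤ r := fun r hr => csInf_le hbdd hr
  refine ⟨?_, hlow⟩
  obtain ⟨r, hr, hrlt⟩ := exists_lt_of_csInf_lt hne (lt_add_of_pos_right (gap C x) hc)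
  rcases (hlow r hr).eq_or_lt with h | h
  · rwa [h]
  · exfalso
    obtain ⟨t, ht, htr⟩ := exists_lt_of_csInf_lt hne h
    have hlt := hlow t ht
    have hmem : (r - t) +ᵥ (t +ᵥ x) ∈ C := by
      rw [vadd_vadd, sub_add_cancel]; exact hr.2
    have hcle := hlac (t +ᵥ x) ht.2 (r - t) (sub_pos.2 htr)
      ⟨hmem, fun h0 => (sub_pos.2 htr).ne' (hfree _ _ h0)⟩
    linarith

/-- A cross section is sparse if its gaps are unbounded in both directions on each orbit. -/
def IsSparseCrossSection [MeasurableSpace Ω] (C : Set Ω) : Prop :=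
  IsCrossSection C ∧ ∀ x ∈ C, ∀ K : ℝ,
    (∃ r : ℝ, 0 ≤ r ∧ r +ᵥ x ∈ C ∧ K ≤ gap C (r +ᵥ x)) ∧
    (∃ r : ℝ, r ≤ 0 ∧ r +ᵥ x ∈ C ∧ K ≤ gap C (r +ᵥ x))

/-- The flow is sparse: it admits a sparse cross section. -/
def IsSparse (Ω : Type*) [AddAction ℝ Ω] [MeasurableSpace Ω] : Prop :=
  ∃ C : Set Ω, IsSparseCrossSection C

/-- An `S`-regular cross section: all the gaps belong to `S`. -/
def IsRegularCrossSection [MeasurableSpace Ω] (S : Set ℝ) (C : Set Ω) : Prop :=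
  IsCrossSection C ∧ ∀ x ∈ C, gap C x ∈ S

end BorelFlow

/-! ### Asymptotic density of the generated monoid -/

open Filter Topology

/-! The sums of elements of `S` are asymptotically dense in the half-line, since two of them can
differ by an arbitrarily small positive amount
(`AddSubmonoid.exists_forall_ge_exists_mem_closure_near`). Hence a small shift of its right end
turns a long gap into such a sum, and the gap can then be filled with points spaced by elements of
`S`.

Doing this along a whole orbit needs a Borel place to start. Sparseness provides one at every scale.
For thresholds `K 0 < K 1 < ...` tending to infinity, stage `n` corrects the gaps in `[K n, K (n +
1))` from left to right, restarts with shift 0 after each longer gap, and moves the two ends of a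
shorter gap together. The shifts of stage `n` are at most `ε n`, with summable `ε n`, and a
corrected gap never changes again, so the total shift converges
(`MeasurableEquiv.exists_coboundary_mem`). `BorelFlow.IsCrossSection.exists_isRegularCrossSection`
fills the resulting gaps. -/

theorem AddSubgroup.exists_sub_of_mem_closure {S : Set ℝ} {x : ℝ}
    (hx : x ∈ AddSubgroup.closure S) :
    ∃ a ∈ AddSubmonoid.closure S, ∃ b ∈ AddSubmonoid.closure S, x = a - b := by
  induction hx using AddSubgroup.closure_induction with
  | mem x hx => exact ⟨x, AddSubmonoid.subset_closure hx, 0, zero_mem _, by simp⟩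
  | zero => exact ⟨0, zero_mem _, 0, zero_mem _, by simp⟩
  | add x y _ _ hx hy =>
    obtain ⟨a, ha, b, hb, rfl⟩ := hx
    obtain ⟨a', ha', b', hb', rfl⟩ := hy
    exact ⟨a + a', add_mem ha ha', b + b', add_mem hb hb', by ring⟩
  | neg x _ hx =>
    obtain ⟨a, ha, b, hb, rfl⟩ := hx
    exact ⟨b, hb, a, ha, by ring⟩

/-- The additive monoid generated by positive reals that generate a dense group is
asymptotically dense. -/
theorem AddSubmonoid.exists_forall_ge_exists_mem_closure_near {S : Set ℝ} (hpos : ∀ s ∈ S, 0 < s)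
    (hdense : Dense (AddSubgroup.closure S : Set ℝ)) {ε : ℝ} (hε : 0 < ε) :
    ∃ N : ℝ, ∀ y, N ≤ y → ∃ t ∈ AddSubmonoid.closure S, |t - y| ≤ ε := by
  obtain ⟨g, hg, hg0, hgε⟩ := hdense.exists_between hε
  obtain ⟨a', ha', b', hb', hab⟩ := AddSubgroup.exists_sub_of_mem_closure hg
  obtain ⟨s, hs⟩ : S.Nonempty := by
    by_contra h
    rw [Set.not_nonempty_iff_eq_empty] at h
    subst h
    simp only [AddSubgroup.closure_empty, SetLike.mem_coe, AddSubgroup.mem_bot] at hg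
    exact hg0.ne' hg
  have hnonneg : 0 ≤ b' :=
    (AddSubmonoid.closure_le (S := AddSubmonoid.nonneg ℝ)).2 (fun x hx => (hpos x hx).le) hb'
  -- Adding `s` makes `b` positive even when `b' = 0`.
  set b := b' + s with hb_def
  have hs0 := hpos s hs
  have hb0 : 0 < b := by positivity
  have hb : b ∈ AddSubmonoid.closure S := add_mem hb' (AddSubmonoid.subset_closure hs)
  have ha : b + g ∈ AddSubmonoid.closure S := by
    have : b + g = a' + s := by rw [hb_def, hab]; ring
    rw [this]
    exact add_mem ha' (AddSubmonoid.subset_closure hs)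
  -- The sums `(k - j) • b + j • (b + g)`, `j ≤ k`, climb from `k * b` in steps of `g`; once `k ≥ b
  -- / g` they reach `(k + 1) * b`.
  refine ⟨(⌈b / g⌉₊ + 1) * b, fun y hy => ?_⟩
  have hy0 : 0 ≤ y := le_trans (by positivity) hy
  have hk1 : (⌊y / b⌋₊ : ℝ) * b ≤ y := by
    rw [← le_div_iff₀ hb0]; exact Nat.floor_le (by positivity)
  have hk2 : y < (⌊y / b⌋₊ + 1 : ℝ) * b := by
    rw [← div_lt_iff₀ hb0]; exact Nat.lt_floor_add_one _
  set k := ⌊y / b⌋₊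
  have hk3 : b / g ≤ k := by
    have h1 : ((⌈b / g⌉₊ : ℝ) + 1) * b < (k + 1) * b := lt_of_le_of_lt hy hk2
    have h2 := lt_of_mul_lt_mul_right h1 hb0.le
    have h3 := Nat.le_ceil (b / g)
    linarith
  have hr0 : 0 ≤ y - k * b := by linarith
  have hj1 : (⌊(y - k * b) / g⌋₊ : ℝ) * g ≤ y - k * b := by
    rw [← le_div_iff₀ hg0]; exact Nat.floor_le (by positivity)
  have hj2 : y - k * b < (⌊(y - k * b) / g⌋₊ + 1 : ℝ) * g := by
    rw [← div_lt_iff₀ hg0]; exact Nat.lt_floor_add_one _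
  set j := ⌊(y - k * b) / g⌋₊
  have hjk : j ≤ k := by
    have h1 : (j : ℝ) * g < k * g := by
      have := (div_le_iff₀ hg0).1 hk3
      linarith
    exact_mod_cast (lt_of_mul_lt_mul_right h1 hg0.le).le
  obtain ⟨i, hi⟩ := Nat.exists_eq_add_of_le hjk
  refine ⟨i • b + j • (b + g), add_mem (nsmul_mem hb i) (nsmul_mem ha j), ?_⟩
  have hkr : (k : ℝ) = j + i := by exact_mod_cast hi
  rw [hkr] at hj1 hj2
  simp only [nsmul_eq_mul]
  rw [abs_le]
  constructor <;> linarith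

/-! ### Borel recursion and small coboundaries -/

/-- Measurable recursion along an automorphism whose every backward orbit meets the set `B`,
at whose points the recursion is restarted. -/
theorem MeasurableEquiv.exists_measurable_recursion {X : Type*} [MeasurableSpace X] (φ : X ≃ᵐ X)
    {B : Set X} (hB : MeasurableSet B) (hBφ : ∀ x, ∃ n : ℕ, φ.symm^[n] x ∈ B)
    {F : X → ℝ → ℝ} (hF : Measurable (Function.uncurry F)) {ε : ℝ} (hε : 0 ≤ ε) :
    ∃ δ : X → ℝ, Measurable δ ∧ (∀ x ∈ B, δ (φ x) = 0) ∧
      (∀ x ∉ B, δ (φ x) = F x (δ x)) ∧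
      ((∀ x ∉ B, ∀ d, |d| ≤ ε → |F x d| ≤ ε) → ∀ x, |δ x| ≤ ε) := by
  classical
  -- `u k` runs the recursion from 0 over the last `k` steps. It is stationary in `k` once these
  -- steps reach back to `B`, so its pointwise limit is measurable.
  let u : ℕ → X → ℝ := fun k => Nat.rec (fun _ => 0)
    (fun _ v x => if φ.symm x ∈ B then 0 else F (φ.symm x) (v (φ.symm x))) k
  have u_succ : ∀ k x, u (k + 1) x =
      if φ.symm x ∈ B then 0 else F (φ.symm x) (u k (φ.symm x)) := fun _ _ => rfl
  have hu : ∀ k, Measurable (u k) := by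
    intro k
    induction k with
    | zero => exact measurable_const
    | succ k ih =>
      refine Measurable.ite (φ.symm.measurable hB) measurable_const ?_
      exact hF.comp (φ.symm.measurable.prodMk (ih.comp φ.symm.measurable))
  have hconst : ∀ n x, φ.symm^[n] (φ.symm x) ∈ B → ∀ k, n < k → u k x = u (n + 1) x := by
    intro n
    induction n with
    | zero =>
      intro x hx k hk
      obtain ⟨k, rfl⟩ := Nat.exists_eq_add_of_lt hk
      rw [Function.iterate_zero_apply] at hx
      rw [u_succ, u_succ, if_pos hx, if_pos hx]
    | succ n ih =>
      intro x hx k hk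
      obtain ⟨k, rfl⟩ : ∃ l, k = l + 1 := ⟨k - 1, by omega⟩
      rw [u_succ k, u_succ (n + 1)]
      split_ifs with h
      · rfl
      · rw [ih _ (by simpa using hx) k (by omega)]
  choose n hn using fun x => hBφ (φ.symm x)
  have hlim : ∀ x, Tendsto (fun k => u k x) atTop (𝓝 (u (n x + 1) x)) := fun x =>
    tendsto_const_nhds.congr' <| by
      filter_upwards [eventually_gt_atTop (n x)] with k hk
      exact (hconst _ _ (hn x) k hk).symm
  refine ⟨fun x => u (n x + 1) x,
    measurable_of_tendsto_metrizable hu (tendsto_pi_nhds.2 hlim), ?_, ?_, ?_⟩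
  · intro x hx
    simp [u_succ, hx]
  · intro x hx
    have h1 := hconst _ _ (hn (φ x)) (n (φ x) + n x + 2) (by omega)
    have h2 := hconst _ _ (hn x) (n (φ x) + n x + 1) (by omega)
    show u (n (φ x) + 1) (φ x) = F x (u (n x + 1) x)
    rw [← h1, ← h2, u_succ (n (φ x) + n x + 1), φ.symm_apply_apply, if_neg hx]
  · intro h x
    have : ∀ k x, |u k x| ≤ ε := by
      intro k
      induction k with
      | zero => intro x; simpa [u] using hε
      | succ k ih =>
        intro x
        rw [u_succ]
        split_ifs with hx
        · simpa using hε
        · exact h _ hx _ (ih _)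
    exact this (n x + 1) x

/-- A function `g` that is large, and unbounded along each backward orbit of `φ`, can
be altered by a small coboundary so as to take all its values in an asymptotically dense set. -/
theorem MeasurableEquiv.exists_coboundary_mem {T : Set ℝ}
    (hT : ∀ ε : ℝ, 0 < ε → ∃ N : ℝ, ∀ y, N ≤ y → ∃ t ∈ T, |t - y| ≤ ε) {η : ℝ} (hη : 0 < η) :
    ∃ K : ℝ, ∀ {X : Type*} [MeasurableSpace X] (φ : X ≃ᵐ X) (g : X → ℝ), Measurable g →
      (∀ x, K ≤ g x) →
      (∀ x L, ∃ n : ℕ, L ≤ g (φ.symm^[n] x)) →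
      ∃ s : X → ℝ, Measurable s ∧ (∀ x, |s x| ≤ η) ∧ ∀ x, g x + s (φ x) - s x ∈ T := by
  classical
  let ε : ℕ → ℝ := fun n => η / 2 / 2 ^ n
  have hε : ∀ n, 0 < ε n := fun n => by positivity
  have hεsum : HasSum ε η := hasSum_geometric_two' η
  have hτ : ∀ n, ∃ N : ℝ, ∃ τ : ℝ → ℝ, Measurable τ ∧ ∀ y, N ≤ y → τ y ∈ T ∧ |τ y - y| ≤ ε n := by
    intro n
    have hn2 : 0 < ε n / 2 := half_pos (hε n)
    obtain ⟨N, hN⟩ := hT (ε n / 2) hn2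
    choose! h hh using hN
    -- Rounding `y` down to a grid first makes an arbitrary choice `h` measurable, as it then
    -- depends on an integer only.
    refine ⟨N + ε n / 2, fun y => h (⌊y / (ε n / 2)⌋ * (ε n / 2)), ?_, ?_⟩
    · exact (measurable_from_top (f := fun m : ℤ => h (m * (ε n / 2)))).comp
        (Int.measurable_floor.comp (measurable_id.div_const _))
    · intro y hy
      have h1 : (⌊y / (ε n / 2)⌋ : ℝ) * (ε n / 2) ≤ y := by
        rw [← le_div_iff₀ hn2]; exact Int.floor_le _
      have h2 : y < (⌊y / (ε n / 2)⌋ + 1 : ℝ) * (ε n / 2) := by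
        rw [← div_lt_iff₀ hn2]; exact Int.lt_floor_add_one _
      obtain ⟨h3, h4⟩ := hh (⌊y / (ε n / 2)⌋ * (ε n / 2)) (by linarith)
      refine ⟨h3, ?_⟩
      rw [abs_le] at h4 ⊢
      constructor <;> linarith
  choose N τ hτm hτT using hτ
  -- The slack `3 * η` absorbs the shifts `s (φ x)`, `s x` and `δ x`; the increments of 1 send `K n`
  -- to infinity.
  obtain ⟨K, hKN, hKs⟩ : ∃ K : ℕ → ℝ, (∀ n, N n + 3 * η ≤ K n) ∧ ∀ n, K n + 1 ≤ K (n + 1) := by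
    let K : ℕ → ℝ := fun n => Nat.rec (N 0 + 3 * η) (fun n k => max (k + 1) (N (n + 1) + 3 * η)) n
    have K_succ : ∀ n, K (n + 1) = max (K n + 1) (N (n + 1) + 3 * η) := fun _ => rfl
    refine ⟨K, ?_, fun n => by rw [K_succ]; exact le_max_left _ _⟩
    rintro (_ | n)
    · exact le_rfl
    · rw [K_succ]; exact le_max_right _ _
  have hKmono : Monotone K := monotone_nat_of_le_succ fun n => by linarith [hKs n]
  have hKn : ∀ n : ℕ, K 0 + n ≤ K n := by
    intro n
    induction n with
    | zero => simp
    | succ n ih => push_cast; linarith [hKs n]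
  refine ⟨K 0, ?_⟩
  intro X _ φ g hg hK hunb
  -- Stage `n`. A new shift is either copied or a single rounding error, so errors do not accumulate
  -- along the orbit.
  have hstep : ∀ (n : ℕ) (s : X → ℝ), Measurable s → ∃ δ : X → ℝ, Measurable δ ∧
      (∀ x, g x < K n → δ (φ x) = δ x) ∧
      (∀ x, K n ≤ g x → g x < K (n + 1) →
        (δ (φ x) = τ n (g x + s (φ x) - s x - δ x) - (g x + s (φ x) - s x - δ x))) ∧
      ((∀ x, |s x| ≤ η) → ∀ x, |δ x| ≤ ε n) := by
    intro n s hs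
    have hsd : Measurable fun p : X × ℝ => g p.1 + s (φ p.1) - s p.1 - p.2 :=
      (((hg.comp measurable_fst).add (hs.comp (φ.measurable.comp measurable_fst))).sub
        (hs.comp measurable_fst)).sub measurable_snd
    let F : X → ℝ → ℝ := fun x d => if g x < K n then d else
      τ n (g x + s (φ x) - s x - d) - (g x + s (φ x) - s x - d)
    have hF : Measurable (Function.uncurry F) :=
      Measurable.ite (measurableSet_lt (hg.comp measurable_fst) measurable_const)
        measurable_snd (((hτm n).comp hsd).sub hsd)
    obtain ⟨δ, hδ, -, hδ1, hδ2⟩ := φ.exists_measurable_recursion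
      (B := {x | K (n + 1) ≤ g x}) (measurableSet_le measurable_const hg)
      (fun x => hunb x _) hF (hε n).le
    refine ⟨δ, hδ, ?_, ?_, ?_⟩
    · intro x hx
      rw [hδ1 x (by simpa using lt_of_lt_of_le hx (hKmono n.le_succ))]
      exact if_pos hx
    · intro x hx hx'
      rw [hδ1 x (by simpa using hx')]
      exact if_neg (not_lt.2 hx)
    · intro hsη
      refine hδ2 fun x _ d hd => ?_
      dsimp only [F]
      split_ifs with hx
      · exact hd
      · refine (hτT n _ ?_).2
        have h1 := abs_le.1 (hsη x)
        have h2 := abs_le.1 (hsη (φ x))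
        have h3 := abs_le.1 hd
        have h4 : ε n ≤ η := le_hasSum hεsum n fun _ _ => (hε _).le
        have := hKN n
        linarith
  choose! δ hδm hδlt hδeq hδε using hstep
  let s : ℕ → X → ℝ := fun n => Nat.rec (fun _ => 0) (fun n v => v + δ n v) n
  have s_succ : ∀ n x, s (n + 1) x = s n x + δ n (s n) x := fun _ _ => rfl
  have hsm : ∀ n, Measurable (s n) := by
    intro n
    induction n with
    | zero => exact measurable_const
    | succ n ih => exact ih.add (hδm n _ ih)
  have hsη' : ∀ n x, |s n x| ≤ ∑ i ∈ Finset.range n, ε i := by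
    intro n
    induction n with
    | zero => intro x; simp [s]
    | succ n ih =>
      intro x
      rw [s_succ, Finset.sum_range_succ]
      refine (abs_add_le _ _).trans (add_le_add (ih x) (hδε n _ (hsm n) (fun x => ?_) x))
      exact (ih x).trans (sum_le_hasSum _ (fun _ _ => (hε _).le) hεsum)
  have hsη : ∀ n x, |s n x| ≤ η := fun n x =>
    (hsη' n x).trans (sum_le_hasSum _ (fun _ _ => (hε _).le) hεsum)
  have hlim : ∀ x, ∃ l, Tendsto (fun n => s n x) atTop (𝓝 l) := fun x =>
    cauchySeq_tendsto_of_complete <| cauchySeq_of_dist_le_of_summable ε (fun n => by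
      rw [dist_comm, Real.dist_eq, s_succ, add_sub_cancel_left]
      exact hδε n _ (hsm n) (hsη n) x) hεsum.summable
  choose σ hσ using hlim
  refine ⟨σ, measurable_of_tendsto_metrizable hsm (tendsto_pi_nhds.2 hσ),
    fun x => le_of_tendsto (hσ x).abs (Eventually.of_forall fun n => hsη n x), fun x => ?_⟩
  have hex : ∃ n, g x < K (n + 1) := by
    obtain ⟨n, hn⟩ := exists_nat_gt (g x - K 0)
    exact ⟨n, by linarith [hKn n, hKs n]⟩
  obtain ⟨n, hn1, hn2⟩ : ∃ n, K n ≤ g x ∧ g x < K (n + 1) := by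
    refine ⟨Nat.find hex, ?_, Nat.find_spec hex⟩
    rcases h : Nat.find hex with _ | m
    · exact hK x
    · exact not_lt.1 (Nat.find_min hex (m := m) (by omega))
  set y := g x + s n (φ x) - s n x - δ n (s n) x with hy
  have hyT : τ n y ∈ T := by
    refine (hτT n _ ?_).1
    have h1 := abs_le.1 (hsη n x)
    have h2 := abs_le.1 (hsη n (φ x))
    have h3 := abs_le.1 (hδε n _ (hsm n) (hsη n) x)
    have h4 : ε n ≤ η := le_hasSum hεsum n fun _ _ => (hε _).le
    have := hKN n
    linarith
  -- From stage `n + 1` on, both ends of this gap receive the same shift.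
  have hconst : ∀ m, g x + s (n + 1 + m) (φ x) - s (n + 1 + m) x = τ n y := by
    intro m
    induction m with
    | zero =>
      rw [add_zero, s_succ, s_succ, hδeq n _ (hsm n) x hn1 hn2]
      ring
    | succ m ih =>
      rw [← add_assoc, s_succ, s_succ,
        hδlt _ _ (hsm _) x (hn2.trans_le (hKmono (Nat.le_add_right (n + 1) m)))]
      linarith
  have h1 : Tendsto (fun m => g x + s m (φ x) - s m x) atTop (𝓝 (g x + σ (φ x) - σ x)) :=
    ((hσ (φ x)).const_add _).sub (hσ x)
  have h2 : Tendsto (fun m => g x + s m (φ x) - s m x) atTop (𝓝 (τ n y)) :=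
    tendsto_const_nhds.congr' <| by
      filter_upwards [eventually_ge_atTop (n + 1)] with m hm
      obtain ⟨m, rfl⟩ := Nat.exists_eq_add_of_le hm
      exact (hconst m).symm
  rwa [tendsto_nhds_unique h1 h2]

/-! ### Countable generation and partial sums -/

/-- A generating set of a dense subgroup of `ℝ` may be taken countable. -/
theorem AddSubgroup.exists_countable_subset_dense_closure {S : Set ℝ}
    (hdense : Dense (AddSubgroup.closure S : Set ℝ)) :
    ∃ S' ⊆ S, S'.Countable ∧ Dense (AddSubgroup.closure S' : Set ℝ) := by
  obtain ⟨S', hS', hc, hd⟩ := (TopologicalSpace.IsSeparable.of_separableSpace S)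
    |>.exists_countable_dense_subset
  refine ⟨S', hS', hc, ?_⟩
  have : AddSubgroup.closure S ≤ (AddSubgroup.closure S').topologicalClosure :=
    (AddSubgroup.closure_le _).2 (hd.trans (_root_.closure_mono AddSubgroup.subset_closure))
  exact dense_closure.1 (hdense.mono this)

theorem Set.Countable.addSubmonoid_closure {S : Set ℝ} (hS : S.Countable) :
    (AddSubmonoid.closure S : Set ℝ).Countable := by
  have := hS.to_subtype
  refine (Set.countable_range fun l : List S => (l.map (↑)).sum).mono fun x hx => ?_
  obtain ⟨l, hl, rfl⟩ := AddSubmonoid.exists_list_of_mem_closure hx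
  lift l to List S using hl
  exact ⟨l, rfl⟩

theorem List.sum_take_le_sum_take {l : List ℝ} (hl : ∀ a ∈ l, 0 ≤ a) {i j : ℕ} (hij : i ≤ j) :
    (l.take i).sum ≤ (l.take j).sum :=
  (List.take_sublist_take_left hij).sum_le_sum fun a ha => hl a (List.mem_of_mem_take ha)

/-! ### The successor map and sparse sections with large gaps -/

namespace BorelFlow

variable {Ω : Type*} [AddAction ℝ Ω] {C : Set Ω}

theorem gap_le {x : Ω} {r : ℝ} (hr : 0 < r) (hx : r +ᵥ x ∈ C) : gap C x ≤ r :=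
  csInf_le ⟨0, fun _ h => h.1.le⟩ ⟨hr, hx⟩

variable [MeasurableSpace Ω]

namespace IsCrossSection

theorem gap_pos (hfree : IsFree Ω) (hC : IsCrossSection C) {x : Ω} (hx : x ∈ C) : 0 < gap C x :=
  (isLeast_gap hfree hC hx).1.1

theorem gap_vadd_mem (hfree : IsFree Ω) (hC : IsCrossSection C) {x : Ω} (hx : x ∈ C) :
    gap C x +ᵥ x ∈ C :=
  (isLeast_gap hfree hC hx).1.2

theorem exists_pos_le_gap (hfree : IsFree Ω) (hC : IsCrossSection C) :
    ∃ c, 0 < c ∧ ∀ x ∈ C, c ≤ gap C x := by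
  obtain ⟨c, hc, h⟩ := hC.lacunary
  refine ⟨c, hc, fun x hx =>
    h x hx _ (hC.gap_pos hfree hx) ⟨hC.gap_vadd_mem hfree hx, fun h0 => ?_⟩⟩
  exact (hC.gap_pos hfree hx).ne' (hfree _ _ h0)

/-- The successor map of a cross section. -/
noncomputable def next (hfree : IsFree Ω) (hC : IsCrossSection C) (x : C) : C :=
  ⟨gap C (x : Ω) +ᵥ (x : Ω), hC.gap_vadd_mem hfree x.2⟩

theorem coe_next (hfree : IsFree Ω) (hC : IsCrossSection C) (x : C) :
    (hC.next hfree x : Ω) = gap C (x : Ω) +ᵥ (x : Ω) := rfl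

theorem exists_iterate_next_eq (hfree : IsFree Ω) (hC : IsCrossSection C) {x y : C} {r : ℝ}
    (hr : 0 ≤ r) (hy : (y : Ω) = r +ᵥ (x : Ω)) : ∃ n : ℕ, (hC.next hfree)^[n] x = y := by
  obtain ⟨c, hc, hcg⟩ := hC.exists_pos_le_gap hfree
  obtain ⟨n, hn⟩ := exists_nat_gt (r / c)
  rw [div_lt_iff₀ hc] at hn
  induction n generalizing x r with
  | zero => simp only [Nat.cast_zero, zero_mul] at hn; linarith
  | succ n ih =>
    rcases hr.eq_or_lt with rfl | hr
    · exact ⟨0, Subtype.ext (by simp [hy])⟩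
    · have h1 : gap C (x : Ω) ≤ r := gap_le hr (hy ▸ y.2)
      have h2 := hcg x x.2
      push_cast at hn
      obtain ⟨k, hk⟩ := ih (x := hC.next hfree x) (r := r - gap C (x : Ω)) (by linarith)
        (by rw [coe_next, vadd_vadd, sub_add_cancel, hy]) (by linarith)
      exact ⟨k + 1, hk⟩

theorem next_injective (hfree : IsFree Ω) (hC : IsCrossSection C) :
    Function.Injective (hC.next hfree) := by
  have key : ∀ x y : C, hC.next hfree x = hC.next hfree y →
      ¬ gap C (x : Ω) < gap C (y : Ω) := by
    intro x y h hlt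
    have h' : gap C (x : Ω) +ᵥ (x : Ω) = gap C (y : Ω) +ᵥ (y : Ω) := congrArg Subtype.val h
    have h2 : (x : Ω) = (gap C (y : Ω) - gap C (x : Ω)) +ᵥ (y : Ω) := by
      rw [sub_eq_neg_add, ← vadd_vadd, ← h', neg_vadd_vadd]
    have h3 := gap_le (C := C) (sub_pos.2 hlt) (h2 ▸ x.2)
    linarith [hC.gap_pos hfree x.2]
  intro x y h
  have h' : gap C (x : Ω) +ᵥ (x : Ω) = gap C (y : Ω) +ᵥ (y : Ω) := congrArg Subtype.val h
  have heq : gap C (x : Ω) = gap C (y : Ω) :=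
    le_antisymm (not_lt.1 (key y x h.symm)) (not_lt.1 (key x y h))
  rw [heq] at h'
  exact Subtype.ext (AddAction.injective _ h')

theorem next_surjective (hfree : IsFree Ω) (hC : IsCrossSection C) :
    Function.Surjective (hC.next hfree) := by
  intro x
  obtain ⟨r, hr, hrx⟩ := hC.exists_before x x.2
  obtain ⟨n, hn⟩ := hC.exists_iterate_next_eq hfree (x := ⟨_, hrx⟩) (y := x) (r := -r)
    (by linarith) (by simp)
  rcases n with _ | n
  · exact absurd (hfree _ _ (congrArg Subtype.val hn)) hr.ne
  · exact ⟨_, by rw [← Function.iterate_succ_apply' (hC.next hfree), hn]⟩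

variable [StandardBorelSpace Ω] [MeasurableVAdd₂ ℝ Ω]

/-- Times at which an orbit meets `C` are at least `c` apart, so each piece `⌊r / c⌋ = j` contains
at most one. The set is thus a countable union of injective Borel images, Borel by Lusin–Souslin. -/
theorem measurableSet_exists_vadd_mem (hfree : IsFree Ω) (hC : IsCrossSection C) {I : Set ℝ}
    (hI : MeasurableSet I) : MeasurableSet {x : Ω | ∃ r ∈ I, r +ᵥ x ∈ C} := by
  obtain ⟨c, hc, hcg⟩ := hC.exists_pos_le_gap hfree
  have heq : {x : Ω | ∃ r ∈ I, r +ᵥ x ∈ C} = ⋃ j : ℤ, (fun p : ℝ × Ω => -p.1 +ᵥ p.2) ''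
      ((I ∩ {r | ⌊r / c⌋ = j}) ×ˢ C) := by
    ext x
    simp only [Set.mem_ofPred_eq, Set.mem_iUnion, Set.mem_image, Set.mem_prod, Set.mem_inter_iff,
      Prod.exists]
    constructor
    · rintro ⟨r, hr, hx⟩
      exact ⟨_, r, r +ᵥ x, ⟨⟨hr, rfl⟩, hx⟩, by simp⟩
    · rintro ⟨j, r, y, ⟨⟨hr, -⟩, hy⟩, rfl⟩
      exact ⟨r, hr, by simpa using hy⟩
  rw [heq]
  refine MeasurableSet.iUnion fun j => MeasurableSet.image_of_measurable_injOn ?_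
    (measurable_fst.neg.vadd measurable_snd) ?_
  · refine (hI.inter ?_).prod hC.measurableSet
    exact (Int.measurable_floor.comp (measurable_id.div_const c)) (measurableSet_singleton j)
  · have key : ∀ p ∈ (I ∩ {r | ⌊r / c⌋ = j}) ×ˢ C, ∀ q ∈ (I ∩ {r | ⌊r / c⌋ = j}) ×ˢ C,
        -p.1 +ᵥ p.2 = -q.1 +ᵥ q.2 → ¬ p.1 < q.1 := by
      rintro ⟨r, y⟩ ⟨⟨-, hr⟩, hy⟩ ⟨r', y'⟩ ⟨⟨-, hr'⟩, hy'⟩ h hlt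
      simp only [Set.mem_ofPred_eq] at hr hr' hy hy' h hlt
      have h2 : y' = (r' - r) +ᵥ y := by
        rw [sub_eq_add_neg, ← vadd_vadd, h, vadd_neg_vadd]
      have h3 : c ≤ r' - r := (hcg y hy).trans (gap_le (sub_pos.2 hlt) (h2 ▸ hy'))
      have h4 := Int.abs_sub_lt_one_of_floor_eq_floor (hr.trans hr'.symm)
      rw [← sub_div, abs_lt, lt_div_iff₀ hc] at h4
      linarith
    intro p hp q hq h
    have h1 : p.1 = q.1 :=
      le_antisymm (not_lt.1 (key q hq p hp h.symm)) (not_lt.1 (key p hp q hq h))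
    simp only [h1] at h
    exact Prod.ext h1 (AddAction.injective _ h)

theorem measurable_gap (hfree : IsFree Ω) (hC : IsCrossSection C) :
    Measurable fun x : C => gap C (x : Ω) := by
  refine measurable_of_Iio fun a => ?_
  convert measurable_subtype_coe (hC.measurableSet_exists_vadd_mem hfree (I := Set.Ioo 0 a)
    measurableSet_Ioo) using 1
  ext x
  simp only [Set.mem_preimage, Set.mem_Iio, Set.mem_ofPred_eq]
  constructor
  · exact fun h => ⟨_, ⟨hC.gap_pos hfree x.2, h⟩, hC.gap_vadd_mem hfree x.2⟩
  · rintro ⟨r, hr, hrx⟩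
    exact (gap_le hr.1 hrx).trans_lt hr.2

theorem measurable_next (hfree : IsFree Ω) (hC : IsCrossSection C) :
    Measurable (hC.next hfree) :=
  ((hC.measurable_gap hfree).vadd measurable_subtype_coe).subtype_mk

/-- The successor map as a Borel automorphism of the cross section. -/
noncomputable def nextEquiv (hfree : IsFree Ω) (hC : IsCrossSection C) : C ≃ᵐ C :=
  haveI := hC.measurableSet.standardBorel
  { toEquiv := Equiv.ofBijective _ ⟨hC.next_injective hfree, hC.next_surjective hfree⟩
    measurable_toFun := hC.measurable_next hfree
    measurable_invFun := by
      have h := (hC.measurable_next hfree).measurableEmbedding (hC.next_injective hfree)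
      intro s hs
      rw [← Equiv.image_eq_preimage_symm]
      exact h.measurableSet_image.2 hs }

end IsCrossSection

variable [StandardBorelSpace Ω] [MeasurableVAdd₂ ℝ Ω]

/-- A sparse flow has sparse cross sections with arbitrarily large gaps. -/
theorem IsSparse.exists_le_gap (hfree : IsFree Ω) (hsparse : IsSparse Ω) (K : ℝ) :
    ∃ C : Set Ω, IsSparseCrossSection C ∧ ∀ x ∈ C, K ≤ gap C x := by
  obtain ⟨C, hC, hCs⟩ := hsparse
  let D : Set Ω := {x | x ∈ C ∧ K ≤ gap C x}
  have hDC : D ⊆ C := fun x hx => hx.1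
  have hD : IsCrossSection D := by
    refine ⟨?_, fun ω => ?_, ?_, fun x hx => ?_, fun x hx => ?_⟩
    · have : D = Subtype.val '' {x : C | K ≤ gap C (x : Ω)} := by
        ext x
        simp [D, and_comm]
      rw [this]
      exact hC.measurableSet.subtype_image
        (measurableSet_le measurable_const (hC.measurable_gap hfree))
    · obtain ⟨x, hx, hxω⟩ := hC.inter_orbit_nonempty ω
      obtain ⟨r, -, hr, hK⟩ := (hCs x hx K).1
      refine ⟨r +ᵥ x, ⟨hr, hK⟩, ?_⟩
      rw [AddAction.mem_orbit_iff] at hxω ⊢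
      obtain ⟨t, rfl⟩ := hxω
      exact ⟨r + t, (vadd_vadd _ _ _).symm⟩
    · obtain ⟨c, hc, h⟩ := hC.lacunary
      exact ⟨c, hc, fun x hx r hr hrx => h x hx.1 r hr ⟨hrx.1.1, hrx.2⟩⟩
    · obtain ⟨t, ht, htx⟩ := hC.exists_after x hx.1
      obtain ⟨r, hr, hrt, hK⟩ := (hCs _ htx K).1
      rw [vadd_vadd] at hrt hK
      exact ⟨r + t, by linarith, hrt, hK⟩
    · obtain ⟨t, ht, htx⟩ := hC.exists_before x hx.1
      obtain ⟨r, hr, hrt, hK⟩ := (hCs _ htx K).2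
      rw [vadd_vadd] at hrt hK
      exact ⟨r + t, by linarith, hrt, hK⟩
  have hgap : ∀ x ∈ D, gap C x ≤ gap D x := fun x hx =>
    gap_le (hD.gap_pos hfree hx) (hDC (hD.gap_vadd_mem hfree hx))
  refine ⟨D, ⟨hD, fun x hx L => ?_⟩, fun x hx => hx.2.trans (hgap x hx)⟩
  obtain ⟨⟨r, hr, hrx, hL⟩, ⟨r', hr', hrx', hL'⟩⟩ := hCs x hx.1 (max K L)
  have h1 : r +ᵥ x ∈ D := ⟨hrx, (le_max_left _ _).trans hL⟩
  have h2 : r' +ᵥ x ∈ D := ⟨hrx', (le_max_left _ _).trans hL'⟩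
  exact ⟨⟨r, hr, h1, ((le_max_right _ _).trans hL).trans (hgap _ h1)⟩,
    ⟨r', hr', h2, ((le_max_right _ _).trans hL').trans (hgap _ h2)⟩⟩

end BorelFlow

/-! ### Filling the shifted gaps -/

namespace BorelFlow

variable {Ω : Type*} [AddAction ℝ Ω] {C : Set Ω}

/-- Small shifts of the points of a cross section with large gaps preserve their order. -/
theorem shift_le_of_one_le_gap (hgap : ∀ x ∈ C, 1 ≤ gap C x)
    {s : C → ℝ} (hs : ∀ x, |s x| ≤ 1 / 4) {x y : C} {d : ℝ} (hd : 0 ≤ d)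
    (hy : (y : Ω) = d +ᵥ (x : Ω)) : s x ≤ d + s y := by
  rcases hd.eq_or_lt with rfl | hd
  · rw [zero_vadd] at hy
    rw [Subtype.ext hy, zero_add]
  · have h1 := (hgap x x.2).trans (gap_le hd (hy ▸ y.2))
    have h2 := abs_le.1 (hs x)
    have h3 := abs_le.1 (hs y)
    linarith

variable [MeasurableSpace Ω]

/-- It suffices to check the local conditions of regularity for a set meeting every orbit. -/
theorem isRegularCrossSection_of_forall_exists {S : Set ℝ} (hpos : ∀ s ∈ S, 0 < s)
    (haway : ∃ c : ℝ, 0 < c ∧ ∀ s ∈ S, c ≤ s) (hm : MeasurableSet C)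
    (horb : ∀ ω : Ω, (C ∩ AddAction.orbit ℝ ω).Nonempty)
    (hnext : ∀ x ∈ C, ∃ a ∈ S, a +ᵥ x ∈ C ∧ ∀ r : ℝ, 0 < r → r +ᵥ x ∈ C → a ≤ r)
    (hbefore : ∀ x ∈ C, ∃ r : ℝ, r < 0 ∧ r +ᵥ x ∈ C) : IsRegularCrossSection S C := by
  obtain ⟨c, hc, hcS⟩ := haway
  refine ⟨⟨hm, horb, ⟨c, hc, fun x hx r hr hrx => ?_⟩, fun x hx => ?_, hbefore⟩, fun x hx => ?_⟩
  · obtain ⟨a, ha, -, h⟩ := hnext x hx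
    exact (hcS a ha).trans (h r hr hrx.1)
  · obtain ⟨a, ha, hax, -⟩ := hnext x hx
    exact ⟨a, hpos a ha, hax⟩
  · obtain ⟨a, ha, hax, h⟩ := hnext x hx
    have : IsLeast {r : ℝ | 0 < r ∧ r +ᵥ x ∈ C} a :=
      ⟨⟨hpos a ha, hax⟩, fun r hr => h r hr.1 hr.2⟩
    rw [gap, this.csInf_eq]
    exact ha

variable [StandardBorelSpace Ω] [MeasurableVAdd₂ ℝ Ω]

/-- If small shifts of the points of a cross section produce gaps that are sums of elements of `S`,
then filling these gaps gives an `S`-regular cross section. -/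
theorem IsCrossSection.exists_isRegularCrossSection (hfree : IsFree Ω) (hC : IsCrossSection C)
    (hgap : ∀ x ∈ C, 1 ≤ gap C x) {S : Set ℝ} (hS : S.Countable) (hpos : ∀ s ∈ S, 0 < s)
    (haway : ∃ c : ℝ, 0 < c ∧ ∀ s ∈ S, c ≤ s) {s : C → ℝ} (hsm : Measurable s)
    (hs : ∀ x, |s x| ≤ 1 / 4)
    (hsS : ∀ x : C, gap C (x : Ω) + s (hC.next hfree x) - s x ∈ AddSubmonoid.closure S) :
    ∃ D : Set Ω, IsRegularCrossSection S D := by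
  have hl : ∀ t ∈ AddSubmonoid.closure S, ∃ l : List ℝ, (∀ a ∈ l, a ∈ S) ∧ l.sum = t :=
    fun t ht => AddSubmonoid.exists_list_of_mem_closure ht
  choose! l hlS hlsum using hl
  set f : C → ℝ := fun x => gap C (x : Ω) + s (hC.next hfree x) - s x with hf
  have hfm : Measurable f :=
    ((hC.measurable_gap hfree).add (hsm.comp (hC.measurable_next hfree))).sub hsm
  have hf0 : ∀ x, 0 < f x := fun x => by
    have h1 := hgap x x.2
    have h2 := abs_le.1 (hs x)
    have h3 := abs_le.1 (hs (hC.next hfree x))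
    simp only [hf]
    linarith
  let q : C → ℕ → ℝ := fun x i => ((l (f x)).take i).sum
  let m : C → ℕ := fun x => (l (f x)).length
  have hnonneg : ∀ x, ∀ a ∈ l (f x), 0 ≤ a := fun x a ha => (hpos a (hlS _ (hsS x) a ha)).le
  have q_mono : ∀ x {i j}, i ≤ j → q x i ≤ q x j := fun x i j hij =>
    List.sum_take_le_sum_take (hnonneg x) hij
  have q_zero : ∀ x, q x 0 = 0 := fun x => by simp [q]
  have q_length : ∀ x, q x (m x) = f x := fun x => by
    simpa [q, m] using hlsum _ (hsS x)
  have m_pos : ∀ x, 0 < m x := fun x => by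
    by_contra h
    have h1 : m x = 0 := by omega
    have := q_length x
    rw [h1, q_zero] at this
    exact (hf0 x).ne this
  -- The strict bound omits the right end of each block, which is the first point of the next one.
  let D : Set Ω := {z | ∃ (x : C) (i : ℕ), i < m x ∧ (q x i + s x) +ᵥ (x : Ω) = z}
  refine ⟨D, isRegularCrossSection_of_forall_exists hpos haway ?_ ?_ ?_ ?_⟩
  -- Splitting over the countably many values `t` of `f` fixes the list `l t`, so no measurability
  -- of `l` is needed.
  · have hD : D = ⋃ t ∈ (AddSubmonoid.closure S : Set ℝ), ⋃ (i : ℕ) (_ : i < (l t).length),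
        (fun x : C => (((l t).take i).sum + s x) +ᵥ (x : Ω)) '' {x | f x = t} := by
      ext z
      simp only [D, q, m, Set.mem_ofPred_eq, Set.mem_iUnion, Set.mem_image, exists_prop]
      constructor
      · rintro ⟨x, i, hi, rfl⟩
        exact ⟨f x, hsS x, i, hi, x, rfl, rfl⟩
      · rintro ⟨t, -, i, hi, x, rfl, rfl⟩
        exact ⟨x, i, hi, rfl⟩
    rw [hD]
    have := hC.measurableSet.standardBorel
    refine MeasurableSet.biUnion hS.addSubmonoid_closure fun t _ =>
      MeasurableSet.iUnion fun i => MeasurableSet.iUnion fun _ =>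
        MeasurableSet.image_of_measurable_injOn (hfm (measurableSet_singleton t))
          ((measurable_const.add hsm).vadd measurable_subtype_coe) ?_
    refine Function.Injective.injOn fun x y hxy => ?_
    have key : ∀ x y : C, (((l t).take i).sum + s x) +ᵥ (x : Ω) =
        (((l t).take i).sum + s y) +ᵥ (y : Ω) → ¬ s y < s x := by
      intro x y hxy hlt
      have hy : (y : Ω) = (s x - s y) +ᵥ (x : Ω) := by
        apply AddAction.injective (((l t).take i).sum + s y)
        simp only
        rw [← hxy, vadd_vadd]
        congr 1
        ring
      have h1 := (hgap x x.2).trans (gap_le (sub_pos.2 hlt) (hy ▸ y.2))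
      have h2 := abs_le.1 (hs x)
      have h3 := abs_le.1 (hs y)
      linarith
    have h : s x = s y := le_antisymm (not_lt.1 (key x y hxy)) (not_lt.1 (key y x hxy.symm))
    simp only [h] at hxy
    exact Subtype.ext (AddAction.injective _ hxy)
  · intro ω
    obtain ⟨x, hx, hxω⟩ := hC.inter_orbit_nonempty ω
    refine ⟨_, ⟨⟨x, hx⟩, 0, m_pos _, rfl⟩, ?_⟩
    rw [AddAction.mem_orbit_iff] at hxω ⊢
    obtain ⟨t, rfl⟩ := hxω
    exact ⟨_, (vadd_vadd _ _ _).symm⟩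
  · rintro _ ⟨x, i, hi, rfl⟩
    have hq : q x (i + 1) = q x i + (l (f x))[i] := List.sum_take_succ _ _ hi
    refine ⟨(l (f x))[i], hlS _ (hsS x) _ (List.getElem_mem hi), ?_, ?_⟩
    · rw [vadd_vadd]
      rcases (Nat.succ_le_of_lt hi).lt_or_eq with h | h
      · refine ⟨x, i + 1, h, ?_⟩
        congr 1
        linarith
      · refine ⟨hC.next hfree x, 0, m_pos _, ?_⟩
        have h1 := q_length x
        rw [← h] at h1
        rw [q_zero, hC.coe_next hfree, vadd_vadd]
        congr 1
        simp only [hf, Nat.succ_eq_add_one] at h1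
        linarith
    · rintro r hr ⟨y, j, hj, hy⟩
      -- `d` is the time from `x` to `y` before shifting. If `d < 0`, the block of `y` ends no later
      -- than that of `x` begins, contradicting `0 < r`; if `d > 0`, it starts no earlier than that
      -- of `x` ends.
      set d := r + q x i + s x - q y j - s y with hd
      have hyd : (y : Ω) = d +ᵥ (x : Ω) := by
        apply AddAction.injective (q y j + s y)
        simp only
        rw [hy, vadd_vadd, vadd_vadd]
        congr 1
        ring
      rcases lt_trichotomy d 0 with h | h | h
      · have hx : (x : Ω) = (-d) +ᵥ (y : Ω) := by rw [hyd, neg_vadd_vadd]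
        have h1 := gap_le (C := C) (neg_pos.2 h) (hx ▸ x.2)
        have h2 := shift_le_of_one_le_gap hgap hs (x := hC.next hfree y) (y := x)
          (sub_nonneg.2 h1) (by rw [hC.coe_next hfree, vadd_vadd, sub_add_cancel, hx])
        have h3 := q_mono y hj.le
        have h4 := q_mono x (Nat.zero_le i)
        rw [q_length] at h3
        rw [q_zero] at h4
        simp only [hf] at h3
        linarith
      · have hxy : y = x := Subtype.ext (by rw [hyd, h, zero_vadd])
        subst hxy
        rcases le_or_gt j i with hji | hij
        · have := q_mono y hji
          linarith
        · have := q_mono y (Nat.succ_le_of_lt hij)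
          rw [Nat.succ_eq_add_one] at this
          linarith
      · have h1 := gap_le (C := C) h (hyd ▸ y.2)
        have h2 := shift_le_of_one_le_gap hgap hs (x := hC.next hfree x) (y := y)
          (sub_nonneg.2 h1) (by rw [hC.coe_next hfree, vadd_vadd, sub_add_cancel, hyd])
        have h3 := q_mono x (Nat.succ_le_of_lt hi)
        have h4 := q_mono y (Nat.zero_le j)
        rw [q_length, Nat.succ_eq_add_one] at h3
        rw [q_zero] at h4
        simp only [hf] at h3
        linarith
  · rintro _ ⟨x, i, hi, rfl⟩
    obtain ⟨y, rfl⟩ := hC.next_surjective hfree x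
    set x := hC.next hfree y with hx
    -- The witness leads to the shifted predecessor of `x` in `C`.
    refine ⟨s y - gap C (y : Ω) - s x - q x i, ?_, y, 0, m_pos y, ?_⟩
    · have h1 := hf0 y
      have h2 := q_mono x (Nat.zero_le i)
      rw [q_zero] at h2
      simp only [hf] at h1
      linarith
    · rw [q_zero, vadd_vadd, hx, hC.coe_next hfree, vadd_vadd]
      congr 1
      ring

end BorelFlow

/-! ### The main theorem -/

theorem theorem2p2 {Ω : Type*} [MeasurableSpace Ω] [StandardBorelSpace Ω]
    [AddAction ℝ Ω] [MeasurableVAdd₂ ℝ Ω]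
    (hfree : BorelFlow.IsFree Ω) (hsparse : BorelFlow.IsSparse Ω)
    (S : Set ℝ) (hpos : ∀ s ∈ S, 0 < s) (haway : ∃ c : ℝ, 0 < c ∧ ∀ s ∈ S, c ≤ s)
    (hdense : Dense (AddSubgroup.closure S : Set ℝ)) :
    ∃ C : Set Ω, BorelFlow.IsRegularCrossSection S C := by
  obtain ⟨S', hS', hcount, hdense'⟩ :=
    AddSubgroup.exists_countable_subset_dense_closure hdense
  have hpos' : ∀ s ∈ S', 0 < s := fun s hs => hpos s (hS' hs)
  have haway' : ∃ c : ℝ, 0 < c ∧ ∀ s ∈ S', c ≤ s :=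
    haway.imp fun c hc => ⟨hc.1, fun s hs => hc.2 s (hS' hs)⟩
  -- Shifts of at most 1/4 change a gap by at most 1/2, so gaps of length at least 1 stay positive.
  obtain ⟨K, hK⟩ := MeasurableEquiv.exists_coboundary_mem
    (T := (AddSubmonoid.closure S' : Set ℝ)) (fun ε hε =>
      AddSubmonoid.exists_forall_ge_exists_mem_closure_near hpos' hdense' hε)
    (η := 1 / 4) (by norm_num)
  obtain ⟨C, ⟨hC, hCs⟩, hgap⟩ := hsparse.exists_le_gap hfree (max K 1)
  obtain ⟨s, hsm, hs, hsT⟩ := hK (hC.nextEquiv hfree) (fun x => BorelFlow.gap C (x : Ω))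
    (hC.measurable_gap hfree) (fun x => (le_max_left _ _).trans (hgap x x.2)) (fun x L => by
      obtain ⟨r, hr, hrx, hL⟩ := (hCs x x.2 L).2
      obtain ⟨n, hn⟩ := hC.exists_iterate_next_eq hfree (x := ⟨_, hrx⟩) (y := x) (r := -r)
        (by linarith) (by simp)
      refine ⟨n, ?_⟩
      rw [← hn]
      have : Function.LeftInverse (hC.nextEquiv hfree).symm (hC.next hfree) :=
        (hC.nextEquiv hfree).symm_apply_apply
      rw [this.iterate n]
      exact hL)
  obtain ⟨D, hD⟩ := hC.exists_isRegularCrossSection hfree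
    (fun x hx => (le_max_right _ _).trans (hgap x hx)) hcount hpos' haway' hsm hs hsT
  exact ⟨D, hD.1, fun x hx => hS' (hD.2 x hx)⟩
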